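/- For a set $A \subseteq \mathbb{R}^d$ let $\dim_H(A)$ denote its Hausdorff dimension, and let its Fourier dimension be $$\dim_F(A) = \sup\Big\{ s \in [0,d] : \sup_{\xi \in \mathbb{R}^d} |\widehat{\mu}(\xi)|^2 |\xi|^s < \infty \text{ for some } \mu \in \mathcal{M}(A) \Big\},$$ where $\mathcal{M}(A)$ is the set of all non-zero finite Borel measures on $\mathbb{R}^d$ with compact support contained in $A$, and $\widehat{\mu}(\xi) = \int e^{-2\pi i x\cdot\xi}\,d\mu(x)$. Theorem. Let $R \subseteq (0,\infty)$ and $Y, Z \subseteq \mathbb{R}^d$ be non-empty compact sets, and write $RY = \{ry : r \in R,\ y \in Y\}$ and $RY+Z = \{ry + z : r \in R,\ y \in Y,\ z \in Z\}$. If $$\max\{\dim_F(RY)+\dim_H(Z),\ \dim_H(RY)+\dim_F(Z)\} \leq d,$$ then $$\dim_H(RY+Z) \geq \max\{\dim_F(RY)+\dim_H(Z),\ \dim_H(RY)+\dim_F(Z)\}.$$ -/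

import Mathlib

open MeasureTheory
open scoped Pointwise NNReal ENNReal

noncomputable section

/-- The Fourier transform `ξ ↦ ∫ exp (-2πi ⟪x, ξ⟫) dμ(x)` of a measure on `ℝ^d`. -/
def measureFourier {d : ℕ} (μ : Measure (EuclideanSpace ℝ (Fin d)))
    (ξ : EuclideanSpace ℝ (Fin d)) : ℂ :=
  ∫ x, Complex.exp (-2 * Real.pi * Complex.I * (inner ℝ x ξ : ℝ)) ∂μ

/-- The set `ℳ(A)` of all non-zero finite Borel measures on `ℝ^d` with compact support
contained in `A`. -/
def compactlySupportedMeasures {d : ℕ} (A : Set (EuclideanSpace ℝ (Fin d))) :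
    Set (Measure (EuclideanSpace ℝ (Fin d))) :=
  {μ | μ ≠ 0 ∧ IsFiniteMeasure μ ∧ IsCompact μ.support ∧ μ.support ⊆ A}

/-- The Fourier dimension of a set `A ⊆ ℝ^d`: the supremum of all `s ∈ [0, d]` such that
`|μ̂(ξ)|² |ξ|^s` is bounded in `ξ` for some `μ ∈ ℳ(A)`. -/
def dimF {d : ℕ} (A : Set (EuclideanSpace ℝ (Fin d))) : ℝ≥0∞ :=
  sSup {t : ℝ≥0∞ | ∃ s : ℝ≥0, t = s ∧ s ≤ d ∧ ∃ μ ∈ compactlySupportedMeasures A,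
    ∃ C : ℝ, ∀ ξ : EuclideanSpace ℝ (Fin d), ‖measureFourier μ ξ‖ ^ 2 * ‖ξ‖ ^ (s : ℝ) ≤ C}

end

/-!
Dimension is measured by the decay in `τ` of the Gaussian self-energy
`E_τ(μ) = ∬ exp (-τ |x - y|²) dμ(x) dμ(y)`: by Parseval it is a Gaussian average of `|μ̂|²`, and by
integration in `τ` it controls the Riesz energies, so that `E_τ(μ) = O(τ^(-u/2))` forces sets of
full `μ`-measure to have Hausdorff dimension at least `u`.

For `s < dim_F A` take `μ ∈ ℳ(A)` with `|μ̂(ξ)|² ≲ |ξ|^(-s)`, and for `t < dim_H Z` a Frostman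
measure `ν` on `Z`, that is `E_τ(ν) = O(τ^(-t/2))`. Since `|(μ ∗ ν)^|² = |μ̂|² |ν̂|²` and `|ξ|^(-s)`
is a superposition of Gaussians, `E_τ(μ ∗ ν)` is bounded by an average of the energies of `ν`. This
average is `O(τ^(-(s+t)/2))` as long as `s + t < d`, and `μ ∗ ν` lives on `A + Z`.

The Frostman measure comes from Hahn–Banach and Riesz–Markov applied to the sublinear functional
sending `f` to the least mass of a measure whose Riesz potential dominates `f` on `Z`. This least
mass is positive for `f = 1`: by a Vitali covering, the set where the Riesz `t`-potential of a
finite measure is infinite is null for the Hausdorff measures of dimension greater than `t`.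
-/

open Set Metric

section RadialIntegrals

lemma lintegral_Ioc_rpow {T a : ℝ} (hT : 0 < T) (ha : 0 < a) :
    ∫⁻ τ in Ioc 0 T, ENNReal.ofReal (τ ^ (a - 1)) = ENNReal.ofReal (T ^ a / a) := by
  have hint : IntegrableOn (fun τ : ℝ ↦ τ ^ (a - 1)) (Ioc 0 T) :=
    (intervalIntegrable_iff_integrableOn_Ioc_of_le hT.le).1
      (intervalIntegral.intervalIntegrable_rpow' (by linarith))
  rw [← ofReal_integral_eq_lintegral_ofReal hint
      ((ae_restrict_mem measurableSet_Ioc).mono fun τ hτ ↦ Real.rpow_nonneg hτ.1.le _),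
    ← intervalIntegral.integral_of_le hT.le, integral_rpow (.inl (by linarith)),
    sub_add_cancel, Real.zero_rpow ha.ne', sub_zero]

lemma lintegral_Ioi_rpow {T c : ℝ} (hT : 0 < T) (hc : 0 < c) :
    ∫⁻ τ in Ioi T, ENNReal.ofReal (τ ^ (-c - 1)) = ENNReal.ofReal (T ^ (-c) / c) := by
  rw [← ofReal_integral_eq_lintegral_ofReal
      (integrableOn_Ioi_rpow_of_lt (by linarith) hT)
      ((ae_restrict_mem measurableSet_Ioi).mono fun τ hτ ↦
        Real.rpow_nonneg (hT.trans hτ).le _),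
    integral_Ioi_rpow_of_lt (by linarith) hT, sub_add_cancel, neg_div_neg_eq]

lemma lintegral_Ioi_rpow_mul_le {g : ℝ → ℝ≥0∞} {a b T : ℝ} {A B : ℝ≥0∞} (ha : 0 < a)
    (hab : a < b) (hT : 0 < T) (hA : ∀ τ ∈ Ioc 0 T, g τ ≤ A)
    (hB : ∀ τ ∈ Ioi T, g τ ≤ B * ENNReal.ofReal (τ ^ (-b))) :
    ∫⁻ τ in Ioi 0, ENNReal.ofReal (τ ^ (a - 1)) * g τ ≤
      A * ENNReal.ofReal (T ^ a / a) + B * ENNReal.ofReal (T ^ (a - b) / (b - a)) := by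
  rw [← Ioc_union_Ioi_eq_Ioi hT.le]
  refine (lintegral_union_le _ _ _).trans (add_le_add ?_ ?_)
  · rw [← lintegral_Ioc_rpow hT ha, ← lintegral_const_mul _ (by fun_prop)]
    refine setLIntegral_mono' measurableSet_Ioc fun τ hτ ↦ ?_
    rw [mul_comm]
    gcongr
    exact hA τ hτ
  · rw [← neg_sub b a, ← lintegral_Ioi_rpow hT (sub_pos.2 hab),
      ← lintegral_const_mul _ (by fun_prop)]
    refine setLIntegral_mono' measurableSet_Ioi fun τ hτ ↦ ?_
    have hτ0 : 0 < τ := hT.trans hτ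
    calc ENNReal.ofReal (τ ^ (a - 1)) * g τ
        ≤ ENNReal.ofReal (τ ^ (a - 1)) * (B * ENNReal.ofReal (τ ^ (-b))) := by
          gcongr; exact hB τ hτ
      _ = B * ENNReal.ofReal (τ ^ (-(b - a) - 1)) := by
          rw [mul_left_comm, ← ENNReal.ofReal_mul (by positivity), ← Real.rpow_add hτ0]
          ring_nf

lemma exists_lintegral_rpow_mul_rpow_add_le {a β : ℝ} (ha : 0 < a) (hβ : a < β) :
    ∃ K : ℝ≥0∞, K ≠ ∞ ∧ ∀ b > 0,
      ∫⁻ τ in Ioi 0, ENNReal.ofReal (τ ^ (a - 1)) * ENNReal.ofReal ((b + τ) ^ (-β)) ≤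
        K * ENNReal.ofReal (b ^ (a - β)) := by
  refine ⟨ENNReal.ofReal (1 / a) + ENNReal.ofReal (1 / (β - a)), by finiteness, fun b hb ↦ ?_⟩
  have hmono {x y : ℝ} (hx : 0 < x) (hxy : x ≤ y) :
      ENNReal.ofReal (y ^ (-β)) ≤ ENNReal.ofReal (x ^ (-β)) :=
    ENNReal.ofReal_le_ofReal (Real.rpow_le_rpow_of_nonpos hx hxy (by linarith))
  refine (lintegral_Ioi_rpow_mul_le (A := ENNReal.ofReal (b ^ (-β))) (B := 1) ha hβ hb
    (fun τ hτ ↦ hmono hb (by linarith [hτ.1])) fun τ hτ ↦ ?_).trans_eq ?_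
  · rw [one_mul]
    exact hmono (hb.trans hτ) (by linarith)
  · have := sub_pos.2 hβ
    rw [add_mul, one_mul, ← ENNReal.ofReal_mul (by positivity),
      ← ENNReal.ofReal_mul (by positivity), ← ENNReal.ofReal_mul (by positivity), mul_div_assoc',
      ← Real.rpow_add hb]
    ring_nf

lemma lintegral_Ioi_rpow_mul_exp_neg_mul {a : ℝ} (ha : 0 < a) {x : ℝ} (hx : 0 ≤ x) :
    ∫⁻ τ in Ioi 0, ENNReal.ofReal (τ ^ (a - 1)) * ENNReal.ofReal (Real.exp (-(τ * x))) =
      ENNReal.ofReal (Real.Gamma a) * ENNReal.ofReal x ^ (-a) := by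
  rcases hx.eq_or_lt with rfl | hx
  · have hdiv : ∫⁻ τ in Ioi (0 : ℝ), ENNReal.ofReal (τ ^ (a - 1)) = ∞ := by
      by_contra htop
      refine not_integrableOn_Ioi_rpow (a - 1) ⟨by fun_prop, ?_⟩
      rwa [hasFiniteIntegral_iff_ofReal ((ae_restrict_mem measurableSet_Ioi).mono
        fun τ hτ ↦ Real.rpow_nonneg (le_of_lt hτ) _), lt_top_iff_ne_top]
    simp [hdiv, ENNReal.mul_top, Real.Gamma_pos_of_pos ha, ha]
  · have hnonneg : ∀ τ ∈ Ioi (0 : ℝ), 0 ≤ τ ^ (a - 1) * Real.exp (-(x * τ)) := fun τ hτ ↦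
      mul_nonneg (Real.rpow_nonneg (le_of_lt hτ) _) (Real.exp_nonneg _)
    have hval := Real.integral_rpow_mul_exp_neg_mul_Ioi ha hx
    have hint : IntegrableOn (fun τ : ℝ ↦ τ ^ (a - 1) * Real.exp (-(x * τ))) (Ioi 0) := by
      refine not_imp_comm.1 integral_undef ?_
      rw [hval]
      have := Real.Gamma_pos_of_pos ha
      positivity
    calc ∫⁻ τ in Ioi 0, ENNReal.ofReal (τ ^ (a - 1)) * ENNReal.ofReal (Real.exp (-(τ * x)))
        = ∫⁻ τ in Ioi 0, ENNReal.ofReal (τ ^ (a - 1) * Real.exp (-(x * τ))) :=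
          setLIntegral_congr_fun measurableSet_Ioi fun τ hτ ↦ by
            simp only [mul_comm τ x]
            rw [← ENNReal.ofReal_mul (Real.rpow_nonneg (le_of_lt hτ) _)]
      _ = ENNReal.ofReal ((1 / x) ^ a * Real.Gamma a) := by
          rw [← ofReal_integral_eq_lintegral_ofReal hint
            ((ae_restrict_mem measurableSet_Ioi).mono hnonneg), hval]
      _ = ENNReal.ofReal (Real.Gamma a) * ENNReal.ofReal x ^ (-a) := by
          rw [mul_comm, ENNReal.ofReal_mul (Real.Gamma_pos_of_pos ha).le,
            ENNReal.ofReal_rpow_of_pos hx, one_div, Real.inv_rpow hx.le, Real.rpow_neg hx.le]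

lemma lintegral_rpow_mul_lintegral_exp_neg_mul {Ω : Type*} [MeasurableSpace Ω] {ρ : Measure Ω}
    [SFinite ρ] {f : Ω → ℝ} {h : Ω → ℝ≥0∞} {a : ℝ} (ha : 0 < a) (hf : Measurable f)
    (hf0 : ∀ ω, 0 ≤ f ω) (hh : Measurable h) :
    ∫⁻ τ in Ioi 0, ENNReal.ofReal (τ ^ (a - 1)) *
        ∫⁻ ω, ENNReal.ofReal (Real.exp (-(τ * f ω))) * h ω ∂ρ =
      ENNReal.ofReal (Real.Gamma a) * ∫⁻ ω, ENNReal.ofReal (f ω) ^ (-a) * h ω ∂ρ := by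
  calc ∫⁻ τ in Ioi 0, ENNReal.ofReal (τ ^ (a - 1)) *
        ∫⁻ ω, ENNReal.ofReal (Real.exp (-(τ * f ω))) * h ω ∂ρ
      = ∫⁻ τ in Ioi 0, ∫⁻ ω, ENNReal.ofReal (τ ^ (a - 1)) *
          (ENNReal.ofReal (Real.exp (-(τ * f ω))) * h ω) ∂ρ :=
        lintegral_congr fun τ ↦ (lintegral_const_mul _ (by fun_prop)).symm
    _ = ∫⁻ ω, (∫⁻ τ in Ioi 0, ENNReal.ofReal (τ ^ (a - 1)) *
          (ENNReal.ofReal (Real.exp (-(τ * f ω))) * h ω)) ∂ρ :=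
        lintegral_lintegral_swap (by fun_prop)
    _ = ∫⁻ ω, ENNReal.ofReal (Real.Gamma a) * (ENNReal.ofReal (f ω) ^ (-a) * h ω) ∂ρ := by
        refine lintegral_congr fun ω ↦ ?_
        simp_rw [← mul_assoc]
        rw [lintegral_mul_const _ (by fun_prop), lintegral_Ioi_rpow_mul_exp_neg_mul ha (hf0 ω)]
    _ = ENNReal.ofReal (Real.Gamma a) * ∫⁻ ω, ENNReal.ofReal (f ω) ^ (-a) * h ω ∂ρ :=
        lintegral_const_mul _ (by fun_prop)

lemma ofReal_sq_rpow_neg_half {r : ℝ} (hr : 0 ≤ r) (s : ℝ) :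
    ENNReal.ofReal (r ^ 2) ^ (-(s / 2)) = ENNReal.ofReal r ^ (-s) := by
  rw [ENNReal.ofReal_pow hr, ← ENNReal.rpow_natCast, ← ENNReal.rpow_mul]
  congr 1
  push_cast
  ring

lemma rpow_mul_exp_neg_le {a x : ℝ} (ha : 0 < a) (hx : 0 ≤ x) :
    x ^ a * Real.exp (-x) ≤ a ^ a := by
  have hbase : x / a ≤ Real.exp (x / a) := by linarith [Real.add_one_le_exp (x / a)]
  calc x ^ a * Real.exp (-x) = a ^ a * ((x / a) ^ a * Real.exp (-x)) := by
        rw [← mul_assoc, ← Real.mul_rpow ha.le (by positivity), mul_div_cancel₀ _ ha.ne']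
    _ ≤ a ^ a * (Real.exp (x / a) ^ a * Real.exp (-x)) := by gcongr
    _ = a ^ a := by
        rw [← Real.exp_mul, div_mul_cancel₀ _ ha.ne', ← Real.exp_add, add_neg_cancel,
          Real.exp_zero, mul_one]

end RadialIntegrals

/-- The Riesz potential `∫ d(x, y)^(-s) dμ(y)` of exponent `s`. It is infinite at every atom of `μ`
if `0 < s`. -/
noncomputable def rieszPotential {X : Type*} [PseudoEMetricSpace X] [MeasurableSpace X] (s : ℝ)
    (μ : Measure X) (x : X) : ℝ≥0∞ :=
  ∫⁻ y, edist x y ^ (-s) ∂μ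

/-- The self-energy of `μ` with respect to the Gaussian kernel `exp (-τ d(x, y)²)`. Its rate of
decay as `τ → ∞` measures the dimension of `μ`. -/
noncomputable def gaussEnergy {X : Type*} [PseudoMetricSpace X] [MeasurableSpace X] (τ : ℝ)
    (μ : Measure X) : ℝ≥0∞ :=
  ∫⁻ p, ENNReal.ofReal (Real.exp (-(τ * dist p.1 p.2 ^ 2))) ∂μ.prod μ

/-- `μ` is at least `s`-dimensional in the sense of energies: its Gaussian self-energy at scale
`r = τ^(-1/2)` is `O(r^s)`. -/
def HasGaussDecay {X : Type*} [PseudoMetricSpace X] [MeasurableSpace X] (μ : Measure X) (s : ℝ) :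
    Prop :=
  ∃ C : ℝ≥0∞, C ≠ ∞ ∧ ∀ τ > 0, gaussEnergy τ μ ≤ C * ENNReal.ofReal (τ ^ (-(s / 2)))

section MassDistribution

variable {X : Type*} [MeasurableSpace X]

lemma measurable_rieszPotential [PseudoEMetricSpace X] [SecondCountableTopology X]
    [OpensMeasurableSpace X] (s : ℝ) (μ : Measure X) [SFinite μ] :
    Measurable (rieszPotential s μ) :=
  (measurable_edist.pow_const (-s)).lintegral_prod_right'

lemma measure_le_mul_ediam_rpow [PseudoEMetricSpace X] [OpensMeasurableSpace X] {μ : Measure X}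
    {v : ℝ} {M : ℝ≥0∞} {x : X} {s : Set X} (hv : 0 ≤ v) (hM : M ≠ ∞)
    (hμ : rieszPotential v μ x ≤ M) (hx : x ∈ s) (hs : ediam s ≠ ∞) :
    μ s ≤ M * ediam s ^ v := by
  have hkernel : s ⊆ {y | (ediam s ^ v)⁻¹ ≤ edist x y ^ (-v)} := fun y hy ↦ by
    rw [mem_ofPred_eq, ENNReal.rpow_neg]
    gcongr
    exact edist_le_ediam_of_mem hx hy
  have hmarkov : (ediam s ^ v)⁻¹ * μ s ≤ M :=
    calc (ediam s ^ v)⁻¹ * μ s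
        ≤ (ediam s ^ v)⁻¹ * μ {y | (ediam s ^ v)⁻¹ ≤ edist x y ^ (-v)} := by gcongr
      _ ≤ rieszPotential v μ x :=
          mul_meas_ge_le_lintegral (measurable_edist_right.pow_const _) _
      _ ≤ M := hμ
  rcases eq_or_ne (ediam s ^ v) 0 with h0 | h0
  · rw [h0, ENNReal.inv_zero] at hmarkov
    have : μ s = 0 := by
      by_contra hne
      exact hM (top_le_iff.1 ((ENNReal.top_mul hne).symm.trans_le hmarkov))
    simp [this]
  · rwa [ENNReal.inv_mul_le_iff h0 (ENNReal.rpow_ne_top_of_nonneg hv hs), mul_comm] at hmarkov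

lemma restrict_le_smul_hausdorffMeasure [EMetricSpace X] [BorelSpace X] {μ : Measure X} {E : Set X}
    {v : ℝ} {M : ℝ≥0∞} (hE : MeasurableSet E) (hv : 0 ≤ v) (hM : M ≠ ∞) (hM0 : M ≠ 0)
    (hμ : ∀ x ∈ E, rieszPotential v μ x ≤ M) : μ.restrict E ≤ M • Measure.hausdorffMeasure v := by
  have hle : M⁻¹ • μ.restrict E ≤ Measure.hausdorffMeasure v := by
    refine Measure.le_hausdorffMeasure _ _ 1 one_pos fun s hs ↦ ?_
    rw [Measure.smul_apply, Measure.restrict_apply' hE, smul_eq_mul, ENNReal.inv_mul_le_iff hM0 hM]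
    rcases (s ∩ E).eq_empty_or_nonempty with hempty | ⟨x, hxs, hxE⟩
    · simp [hempty]
    · exact (measure_mono inter_subset_left).trans
        (measure_le_mul_ediam_rpow hv hM (hμ x hxE) hxs (ne_top_of_le_ne_top ENNReal.one_ne_top hs))
  refine Measure.le_intro fun s _ _ ↦ ?_
  have := hle s
  rwa [Measure.smul_apply, smul_eq_mul, ENNReal.inv_mul_le_iff hM0 hM] at this

lemma le_dimH_of_lintegral_rieszPotential_ne_top [EMetricSpace X] [SecondCountableTopology X]
    [BorelSpace X] {μ : Measure X} [IsFiniteMeasure μ] {S : Set X} {v : ℝ≥0} (hμ : μ ≠ 0)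
    (hS : μ Sᶜ = 0) (hv : ∫⁻ x, rieszPotential v μ x ∂μ ≠ ∞) : (v : ℝ≥0∞) ≤ dimH S := by
  set M : ℝ≥0∞ := (⨍⁻ x, rieszPotential v μ x ∂μ) + 1
  have hMtop : M ≠ ∞ := ENNReal.add_ne_top.2 ⟨(laverage_lt_top hv).ne, ENNReal.one_ne_top⟩
  have hmeas : Measurable (rieszPotential v μ) := measurable_rieszPotential v μ
  set E : Set X := {x | rieszPotential v μ x ≤ M}
  have hE : μ E ≠ 0 := by
    refine ((measure_le_laverage_pos hμ hmeas.aemeasurable).trans_le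
      (measure_mono (t := E) fun x hx ↦ ?_)).ne'
    exact (mem_ofPred.1 hx).trans le_self_add
  refine le_dimH_of_hausdorffMeasure_ne_zero fun hzero ↦ hE ?_
  have hle := restrict_le_smul_hausdorffMeasure (μ := μ) (measurableSet_le hmeas measurable_const)
    v.coe_nonneg hMtop (by simp [M]) (fun x hx ↦ hx) S
  rw [Measure.smul_apply, smul_eq_mul, hzero, mul_zero, nonpos_iff_eq_zero,
    Measure.restrict_apply' (measurableSet_le hmeas measurable_const), inter_comm] at hle
  rwa [← measure_inter_conull hS]

end MassDistribution

section GaussEnergy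

variable {X : Type*} [PseudoMetricSpace X] [MeasurableSpace X]

lemma gaussEnergy_le_measure_univ_sq {τ : ℝ} (hτ : 0 ≤ τ) (μ : Measure X) [SFinite μ] :
    gaussEnergy τ μ ≤ μ univ ^ 2 :=
  calc gaussEnergy τ μ ≤ ∫⁻ _, 1 ∂μ.prod μ := lintegral_mono fun p ↦ by
        rw [ENNReal.ofReal_le_one, Real.exp_le_one_iff, neg_nonpos]
        positivity
    _ = μ univ ^ 2 := by rw [lintegral_one, ← univ_prod_univ, Measure.prod_prod, sq]

variable [SecondCountableTopology X] [OpensMeasurableSpace X]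

lemma lintegral_rpow_mul_gaussEnergy {s : ℝ} (hs : 0 < s) (μ : Measure X) [SFinite μ] :
    ∫⁻ τ in Ioi 0, ENNReal.ofReal (τ ^ (s / 2 - 1)) * gaussEnergy τ μ =
      ENNReal.ofReal (Real.Gamma (s / 2)) * ∫⁻ x, rieszPotential s μ x ∂μ := by
  have htonelli := lintegral_rpow_mul_lintegral_exp_neg_mul (ρ := μ.prod μ)
    (f := fun p ↦ dist p.1 p.2 ^ 2) (h := fun _ ↦ 1) (half_pos hs) (by fun_prop)
    (fun p ↦ sq_nonneg _) measurable_const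
  simp only [mul_one, ofReal_sq_rpow_neg_half dist_nonneg, ← edist_dist] at htonelli
  rw [lintegral_prod _ (by fun_prop)] at htonelli
  exact htonelli

lemma HasGaussDecay.lintegral_rieszPotential_ne_top {μ : Measure X} [IsFiniteMeasure μ] {u v : ℝ}
    (hμ : HasGaussDecay μ u) (hv : 0 < v) (hvu : v < u) : ∫⁻ x, rieszPotential v μ x ∂μ ≠ ∞ := by
  obtain ⟨C, hC, hdecay⟩ := hμ
  have hfin := lintegral_Ioi_rpow_mul_le (half_pos hv) (by linarith : v / 2 < u / 2) one_pos
    (fun τ hτ ↦ gaussEnergy_le_measure_univ_sq hτ.1.le μ)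
    (fun τ hτ ↦ hdecay τ (one_pos.trans hτ))
  rw [lintegral_rpow_mul_gaussEnergy hv] at hfin
  intro htop
  rw [htop, ENNReal.mul_top (by simpa using Real.Gamma_pos_of_pos (half_pos hv))] at hfin
  refine hfin.not_gt (ENNReal.add_lt_top.2 ⟨?_, ?_⟩)
  · exact ENNReal.mul_lt_top (by finiteness) ENNReal.ofReal_lt_top
  · exact ENNReal.mul_lt_top hC.lt_top ENNReal.ofReal_lt_top

end GaussEnergy

lemma HasGaussDecay.le_dimH {X : Type*} [MetricSpace X] [MeasurableSpace X]
    [SecondCountableTopology X] [BorelSpace X] {μ : Measure X} [IsFiniteMeasure μ] {S : Set X}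
    {u v : ℝ≥0} (hdecay : HasGaussDecay μ u) (hvu : v < u) (hμ : μ ≠ 0) (hS : μ Sᶜ = 0) :
    (v : ℝ≥0∞) ≤ dimH S := by
  rcases eq_or_ne v 0 with rfl | hv
  · simp
  · exact le_dimH_of_lintegral_rieszPotential_ne_top hμ hS
      (hdecay.lintegral_rieszPotential_ne_top (by positivity) (by exact_mod_cast hvu))

/-- `|φ(ξ)|² |ξ|^s` is bounded, where `φ(ξ) = ∫ exp (i ⟪x, ξ⟫) dμ(x)`; the normalisation of the
Fourier transform is immaterial here. -/
def HasFourierDecay {V : Type*} [NormedAddCommGroup V] [InnerProductSpace ℝ V] [MeasurableSpace V]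
    (μ : Measure V) (s : ℝ) : Prop :=
  ∃ C : ℝ≥0∞, C ≠ ∞ ∧ ∀ ξ, ‖charFun μ ξ‖ₑ ^ 2 ≤ C * ‖ξ‖ₑ ^ (-s)

lemma HasFourierDecay.mono {V : Type*} [NormedAddCommGroup V] [InnerProductSpace ℝ V]
    [MeasurableSpace V] {μ : Measure V} [IsFiniteMeasure μ] {s s' : ℝ} (hμ : HasFourierDecay μ s)
    (hs' : 0 ≤ s') (hss' : s' ≤ s) : HasFourierDecay μ s' := by
  obtain ⟨C, hC, hdecay⟩ := hμ
  refine ⟨μ univ ^ 2 + C, by finiteness, fun ξ ↦ ?_⟩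
  rcases le_total ‖ξ‖ₑ 1 with hξ | hξ
  · have hmass : ‖charFun μ ξ‖ₑ ≤ μ univ := by
      rw [← ofReal_norm, ← ofReal_measureReal]
      exact ENNReal.ofReal_le_ofReal (norm_charFun_le ξ)
    calc ‖charFun μ ξ‖ₑ ^ 2 ≤ (μ univ ^ 2 + C) * ‖ξ‖ₑ ^ (0 : ℝ) := by
          rw [ENNReal.rpow_zero, mul_one]
          exact le_add_right (by gcongr)
      _ ≤ (μ univ ^ 2 + C) * ‖ξ‖ₑ ^ (-s') := by
          gcongr (μ univ ^ 2 + C) * ?_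
          exact ENNReal.rpow_le_rpow_of_exponent_ge hξ (neg_nonpos.2 hs')
  · calc ‖charFun μ ξ‖ₑ ^ 2 ≤ C * ‖ξ‖ₑ ^ (-s) := hdecay ξ
      _ ≤ (μ univ ^ 2 + C) * ‖ξ‖ₑ ^ (-s') := by
          gcongr
          exact le_add_self

section Parseval

variable {V : Type*} [NormedAddCommGroup V] [InnerProductSpace ℝ V] [SecondCountableTopology V]
  [MeasurableSpace V] [BorelSpace V]

lemma integral_charFun_sub (μ γ : Measure V) [IsFiniteMeasure μ] [IsFiniteMeasure γ] :
    ∫ p, charFun γ (p.1 - p.2) ∂μ.prod μ = ((∫ ξ, ‖charFun μ ξ‖ ^ 2 ∂γ : ℝ) : ℂ) := by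
  have hint : Integrable (Function.uncurry fun (p : V × V) (ξ : V) ↦
      Complex.exp ((inner ℝ ξ (p.1 - p.2) : ℝ) * Complex.I)) ((μ.prod μ).prod γ) := by
    refine Integrable.of_bound (Continuous.aestronglyMeasurable ?_) 1 ?_
    · unfold Function.uncurry
      fun_prop
    · exact ae_of_all _ fun q ↦ (Complex.norm_exp_ofReal_mul_I _).le
  rw [← integral_complex_ofReal]
  simp_rw [charFun_apply (μ := γ)]
  rw [integral_integral_swap hint]
  congr with ξ
  rw [Complex.ofReal_pow, ← Complex.mul_conj', ← charFun_neg, charFun_apply, charFun_apply,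
    ← integral_prod_mul]
  congr with p
  rw [← Complex.exp_add, ← add_mul, ← Complex.ofReal_add, inner_neg_right, inner_sub_right,
    real_inner_comm ξ, real_inner_comm ξ, sub_eq_add_neg]

lemma lintegral_sq_enorm_charFun {μ γ : Measure V} [IsFiniteMeasure μ] [IsFiniteMeasure γ]
    {c τ : ℝ} (hc : 0 ≤ c) (hτ : 0 ≤ τ)
    (hγ : ∀ z, charFun γ z = (c * Real.exp (-(τ * ‖z‖ ^ 2)) : ℝ)) :
    ∫⁻ ξ, ‖charFun μ ξ‖ₑ ^ 2 ∂γ = ENNReal.ofReal c * gaussEnergy τ μ := by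
  have hparseval : ∫ p, c * Real.exp (-(τ * ‖p.1 - p.2‖ ^ 2)) ∂μ.prod μ =
      ∫ ξ, ‖charFun μ ξ‖ ^ 2 ∂γ := by
    have := integral_charFun_sub μ γ
    simp_rw [hγ] at this
    rw [integral_complex_ofReal] at this
    exact_mod_cast this
  have hkernel : Integrable (fun p : V × V ↦ Real.exp (-(τ * ‖p.1 - p.2‖ ^ 2))) (μ.prod μ) := by
    refine Integrable.of_bound (Continuous.aestronglyMeasurable (by fun_prop)) 1
      (ae_of_all _ fun p ↦ ?_)
    rw [Real.norm_of_nonneg (Real.exp_nonneg _), Real.exp_le_one_iff, neg_nonpos]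
    positivity
  have hφ : Integrable (fun ξ ↦ ‖charFun μ ξ‖ ^ 2) γ := by
    refine Integrable.of_bound (measurable_charFun.norm.pow_const 2).aestronglyMeasurable
      (μ.real univ ^ 2) (ae_of_all _ fun ξ ↦ ?_)
    rw [Real.norm_of_nonneg (sq_nonneg _)]
    gcongr
    exact norm_charFun_le ξ
  calc ∫⁻ ξ, ‖charFun μ ξ‖ₑ ^ 2 ∂γ
      = ENNReal.ofReal (∫ ξ, ‖charFun μ ξ‖ ^ 2 ∂γ) := by
        rw [ofReal_integral_eq_lintegral_ofReal hφ (ae_of_all _ fun _ ↦ sq_nonneg _)]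
        simp only [ENNReal.ofReal_pow (norm_nonneg _), ofReal_norm]
    _ = ENNReal.ofReal c * gaussEnergy τ μ := by
        rw [← hparseval, integral_const_mul, ENNReal.ofReal_mul hc,
          ofReal_integral_eq_lintegral_ofReal hkernel (ae_of_all _ fun _ ↦ Real.exp_nonneg _)]
        simp only [gaussEnergy, dist_eq_norm]

end Parseval

section FourierSide

variable {V : Type*} [NormedAddCommGroup V] [InnerProductSpace ℝ V] [FiniteDimensional ℝ V]
  [MeasurableSpace V] [BorelSpace V]

lemma isFiniteMeasure_withDensity_exp_neg_mul_sq_norm {b : ℝ} (hb : 0 < b) :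
    IsFiniteMeasure ((volume : Measure V).withDensity fun ξ ↦
      ENNReal.ofReal (Real.exp (-(b * ‖ξ‖ ^ 2)))) := by
  have hint : Integrable fun ξ : V ↦ Real.exp (-b * ‖ξ‖ ^ 2) := by
    refine not_imp_comm.1 integral_undef ?_
    rw [GaussianFourier.integral_rexp_neg_mul_sq_norm hb]
    positivity
  simpa only [neg_mul] using isFiniteMeasure_withDensity_ofReal hint.2

lemma charFun_withDensity_exp_neg_mul_sq_norm {b : ℝ} (hb : 0 < b) (z : V) :
    charFun ((volume : Measure V).withDensity fun ξ ↦
        ENNReal.ofReal (Real.exp (-(b * ‖ξ‖ ^ 2)))) z =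
      ((Real.pi / b) ^ (Module.finrank ℝ V / 2 : ℝ) *
        Real.exp (-(1 / (4 * b) * ‖z‖ ^ 2)) : ℝ) := by
  rw [charFun_apply, integral_withDensity_eq_integral_toReal_smul (by fun_prop) (by simp)]
  calc ∫ ξ : V, (ENNReal.ofReal (Real.exp (-(b * ‖ξ‖ ^ 2)))).toReal •
        Complex.exp ((inner ℝ ξ z : ℝ) * Complex.I)
      = ∫ ξ : V, Complex.exp (-(b : ℂ) * ‖ξ‖ ^ 2 + Complex.I * (inner ℝ z ξ : ℝ)) := by
        refine integral_congr_ae (ae_of_all _ fun ξ ↦ ?_)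
        dsimp only
        rw [ENNReal.toReal_ofReal (Real.exp_nonneg _), Complex.real_smul, Complex.ofReal_exp,
          ← Complex.exp_add, real_inner_comm ξ z, mul_comm Complex.I]
        push_cast
        ring_nf
    _ = ((Real.pi / b) ^ (Module.finrank ℝ V / 2 : ℝ) *
          Real.exp (-(1 / (4 * b) * ‖z‖ ^ 2)) : ℝ) := by
        rw [GaussianFourier.integral_cexp_neg_mul_sq_norm_add (by simpa), Complex.ofReal_mul,
          Complex.ofReal_cpow (by positivity), Complex.I_sq]
        push_cast
        ring_nf

lemma lintegral_exp_mul_sq_enorm_charFun (μ : Measure V) [IsFiniteMeasure μ] {b : ℝ} (hb : 0 < b) :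
    ∫⁻ ξ, ENNReal.ofReal (Real.exp (-(b * ‖ξ‖ ^ 2))) * ‖charFun μ ξ‖ₑ ^ 2 =
      ENNReal.ofReal ((Real.pi / b) ^ (Module.finrank ℝ V / 2 : ℝ)) *
        gaussEnergy (1 / (4 * b)) μ := by
  have := isFiniteMeasure_withDensity_exp_neg_mul_sq_norm (V := V) hb
  exact (lintegral_withDensity_eq_lintegral_mul _ (by fun_prop)
    (measurable_charFun.enorm.pow_const 2)).symm.trans
    (lintegral_sq_enorm_charFun (by positivity) (by positivity)
      (charFun_withDensity_exp_neg_mul_sq_norm hb))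

lemma hasGaussDecay_iff_charFun {μ : Measure V} [IsFiniteMeasure μ] {t : ℝ} :
    HasGaussDecay μ t ↔ ∃ C : ℝ≥0∞, C ≠ ∞ ∧ ∀ b > 0,
      ∫⁻ ξ, ENNReal.ofReal (Real.exp (-(b * ‖ξ‖ ^ 2))) * ‖charFun μ ξ‖ₑ ^ 2 ≤
        C * ENNReal.ofReal (b ^ (-((Module.finrank ℝ V - t) / 2))) := by
  set n := (Module.finrank ℝ V : ℝ)
  set K : ℝ := Real.pi ^ (n / 2) * 4 ^ (t / 2)
  have hK : 0 < K := by positivity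
  have hscale : ∀ b > 0, ENNReal.ofReal ((Real.pi / b) ^ (n / 2)) *
      ENNReal.ofReal ((1 / (4 * b)) ^ (-(t / 2))) =
        ENNReal.ofReal K * ENNReal.ofReal (b ^ (-((n - t) / 2))) := fun b hb ↦ by
    rw [← ENNReal.ofReal_mul (by positivity), ← ENNReal.ofReal_mul hK.le]
    congr 1
    rw [Real.div_rpow Real.pi_pos.le hb.le, one_div, Real.rpow_neg (by positivity),
      Real.inv_rpow (by positivity), inv_inv, Real.mul_rpow (by norm_num) hb.le,
      show -((n - t) / 2) = t / 2 - n / 2 by ring, Real.rpow_sub hb]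
    ring
  constructor
  · rintro ⟨C, hC, hdecay⟩
    refine ⟨C * ENNReal.ofReal K, by finiteness, fun b hb ↦ ?_⟩
    rw [lintegral_exp_mul_sq_enorm_charFun μ hb, mul_assoc, ← hscale b hb, mul_left_comm]
    gcongr
    exact hdecay _ (by positivity)
  · rintro ⟨C, hC, hdecay⟩
    refine ⟨C * (ENNReal.ofReal K)⁻¹, by finiteness, fun τ hτ ↦ ?_⟩
    have hb : 0 < 1 / (4 * τ) := by positivity
    have hτb : 1 / (4 * (1 / (4 * τ))) = τ := by field_simp
    have hbound := hdecay _ hb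
    have hscale := hscale _ hb
    rw [lintegral_exp_mul_sq_enorm_charFun μ hb, hτb] at hbound
    rw [hτb] at hscale
    refine (ENNReal.mul_le_mul_iff_right ?_ ENNReal.ofReal_ne_top).1 (hbound.trans_eq ?_)
    · simp only [ne_eq, ENNReal.ofReal_eq_zero, not_le]
      positivity
    · rw [mul_left_comm, hscale, mul_assoc, ENNReal.inv_mul_cancel_left ?_ ENNReal.ofReal_ne_top]
      simpa only [ne_eq, ENNReal.ofReal_eq_zero, not_le] using hK

lemma HasGaussDecay.lintegral_rpow_mul_exp_mul_sq_enorm_charFun_le {ν : Measure V}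
    [IsFiniteMeasure ν] {s t : ℝ} (hν : HasGaussDecay ν t) (hs : 0 < s)
    (hst : s + t < Module.finrank ℝ V) :
    ∃ C : ℝ≥0∞, C ≠ ∞ ∧ ∀ b > 0,
      ∫⁻ ξ, ‖ξ‖ₑ ^ (-s) *
          (ENNReal.ofReal (Real.exp (-(b * ‖ξ‖ ^ 2))) * ‖charFun ν ξ‖ₑ ^ 2) ≤
        C * ENNReal.ofReal (b ^ (-((Module.finrank ℝ V - (s + t)) / 2))) := by
  obtain ⟨D, hD, hgauss⟩ := hasGaussDecay_iff_charFun.1 hν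
  set n := (Module.finrank ℝ V : ℝ)
  obtain ⟨K, hK, hbeta⟩ := exists_lintegral_rpow_mul_rpow_add_le (half_pos hs)
    (by linarith : s / 2 < (n - t) / 2)
  set Γ : ℝ≥0∞ := ENNReal.ofReal (Real.Gamma (s / 2))
  have hΓ : Γ ≠ 0 := by simpa [Γ] using Real.Gamma_pos_of_pos (half_pos hs)
  have : Measurable fun ξ ↦ ‖charFun ν ξ‖ₑ ^ 2 := measurable_charFun.enorm.pow_const 2
  refine ⟨Γ⁻¹ * (D * K), by finiteness, fun b hb ↦ ?_⟩
  have hshift : ∀ τ ∈ Ioi (0 : ℝ), ∫⁻ ξ, ENNReal.ofReal (Real.exp (-(τ * ‖ξ‖ ^ 2))) *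
      (ENNReal.ofReal (Real.exp (-(b * ‖ξ‖ ^ 2))) * ‖charFun ν ξ‖ₑ ^ 2) ≤
        D * ENNReal.ofReal ((b + τ) ^ (-((n - t) / 2))) := fun τ hτ ↦ by
    refine le_of_eq_of_le (lintegral_congr fun ξ ↦ ?_) (hgauss (b + τ) (add_pos hb hτ))
    rw [← mul_assoc, ← ENNReal.ofReal_mul (Real.exp_nonneg _), ← Real.exp_add]
    ring_nf
  have hgamma := lintegral_rpow_mul_lintegral_exp_neg_mul (ρ := (volume : Measure V))
    (f := fun ξ ↦ ‖ξ‖ ^ 2)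
    (h := fun ξ ↦ ENNReal.ofReal (Real.exp (-(b * ‖ξ‖ ^ 2))) * ‖charFun ν ξ‖ₑ ^ 2)
    (half_pos hs) (by fun_prop) (fun ξ ↦ sq_nonneg _) (by fun_prop)
  simp only [ofReal_sq_rpow_neg_half (norm_nonneg _), ofReal_norm] at hgamma
  calc ∫⁻ ξ, ‖ξ‖ₑ ^ (-s) *
        (ENNReal.ofReal (Real.exp (-(b * ‖ξ‖ ^ 2))) * ‖charFun ν ξ‖ₑ ^ 2)
      = Γ⁻¹ * ∫⁻ τ in Ioi 0, ENNReal.ofReal (τ ^ (s / 2 - 1)) *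
          ∫⁻ ξ, ENNReal.ofReal (Real.exp (-(τ * ‖ξ‖ ^ 2))) *
            (ENNReal.ofReal (Real.exp (-(b * ‖ξ‖ ^ 2))) * ‖charFun ν ξ‖ₑ ^ 2) := by
        rw [hgamma, ENNReal.inv_mul_cancel_left hΓ ENNReal.ofReal_ne_top]
    _ ≤ Γ⁻¹ * ∫⁻ τ in Ioi 0, D * (ENNReal.ofReal (τ ^ (s / 2 - 1)) *
          ENNReal.ofReal ((b + τ) ^ (-((n - t) / 2)))) := by
        gcongr Γ⁻¹ * ?_
        refine setLIntegral_mono' measurableSet_Ioi fun τ hτ ↦ ?_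
        rw [mul_left_comm]
        gcongr
        exact hshift τ hτ
    _ ≤ Γ⁻¹ * (D * K) * ENNReal.ofReal (b ^ (-((n - (s + t)) / 2))) := by
        rw [lintegral_const_mul _ (by fun_prop), mul_assoc Γ⁻¹, mul_assoc D,
          show -((n - (s + t)) / 2) = s / 2 - (n - t) / 2 by ring]
        gcongr
        exact hbeta b hb

lemma HasFourierDecay.hasGaussDecay_conv {μ ν : Measure V} [IsFiniteMeasure μ] [IsFiniteMeasure ν]
    {s t : ℝ} (hμ : HasFourierDecay μ s) (hν : HasGaussDecay ν t) (hs : 0 < s)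
    (hst : s + t < Module.finrank ℝ V) : HasGaussDecay (μ ∗ ν) (s + t) := by
  obtain ⟨C, hC, hfourier⟩ := hμ
  obtain ⟨D, hD, hgauss⟩ := hν.lintegral_rpow_mul_exp_mul_sq_enorm_charFun_le hs hst
  refine hasGaussDecay_iff_charFun.2 ⟨C * D, by finiteness, fun b hb ↦ ?_⟩
  have : Measurable fun ξ ↦ ‖charFun ν ξ‖ₑ ^ 2 := measurable_charFun.enorm.pow_const 2
  calc ∫⁻ ξ, ENNReal.ofReal (Real.exp (-(b * ‖ξ‖ ^ 2))) * ‖charFun (μ ∗ ν) ξ‖ₑ ^ 2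
      ≤ ∫⁻ ξ, C * (‖ξ‖ₑ ^ (-s) *
          (ENNReal.ofReal (Real.exp (-(b * ‖ξ‖ ^ 2))) * ‖charFun ν ξ‖ₑ ^ 2)) := by
        refine lintegral_mono fun ξ ↦ ?_
        rw [charFun_conv, enorm_mul, mul_pow, mul_left_comm, ← mul_assoc C]
        gcongr
        exact hfourier ξ
    _ ≤ C * D * ENNReal.ofReal (b ^ (-((Module.finrank ℝ V - (s + t)) / 2))) := by
        rw [lintegral_const_mul _ (by fun_prop), mul_assoc]
        gcongr
        exact hgauss b hb

end FourierSide

section EuclideanFourier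

variable {d : ℕ} {μ : Measure (EuclideanSpace ℝ (Fin d))}

lemma measureFourier_eq_charFun (ξ : EuclideanSpace ℝ (Fin d)) :
    measureFourier μ ξ = charFun μ (-(2 * Real.pi) • ξ) := by
  rw [measureFourier, charFun_apply]
  congr with x
  rw [inner_smul_right]
  push_cast
  ring_nf

lemma hasFourierDecay_of_measureFourier_le {s C : ℝ} (hs : 0 < s)
    (h : ∀ ξ, ‖measureFourier μ ξ‖ ^ 2 * ‖ξ‖ ^ s ≤ C) : HasFourierDecay μ s := by
  have hC : 0 < max C 1 * (2 * Real.pi) ^ s := by positivity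
  refine ⟨ENNReal.ofReal (max C 1 * (2 * Real.pi) ^ s), ENNReal.ofReal_ne_top, fun η ↦ ?_⟩
  rcases eq_or_ne η 0 with rfl | hη
  · rw [enorm_zero, ENNReal.zero_rpow_of_neg (neg_neg_of_pos hs),
      ENNReal.mul_top (ENNReal.ofReal_pos.2 hC).ne']
    exact le_top
  · have hη0 : 0 < ‖η‖ := norm_pos_iff.2 hη
    have hbound := h (-(2 * Real.pi)⁻¹ • η)
    rw [measureFourier_eq_charFun, smul_smul, neg_mul_neg,
      mul_inv_cancel₀ Real.two_pi_pos.ne', one_smul, norm_smul, norm_neg,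
      Real.norm_of_nonneg (by positivity), Real.mul_rpow (by positivity) hη0.le,
      Real.inv_rpow Real.two_pi_pos.le] at hbound
    rw [← ofReal_norm, ← ofReal_norm, ENNReal.ofReal_rpow_of_pos hη0, ← ENNReal.ofReal_mul hC.le,
      ← ENNReal.ofReal_pow (norm_nonneg _)]
    refine ENNReal.ofReal_le_ofReal ?_
    rw [Real.rpow_neg hη0.le, ← div_eq_mul_inv, le_div_iff₀ (by positivity)]
    calc ‖charFun μ η‖ ^ 2 * ‖η‖ ^ s
        = ‖charFun μ η‖ ^ 2 * (((2 * Real.pi) ^ s)⁻¹ * ‖η‖ ^ s) * (2 * Real.pi) ^ s := by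
          field_simp
      _ ≤ max C 1 * (2 * Real.pi) ^ s := by
          gcongr
          exact hbound.trans (le_max_left _ _)

end EuclideanFourier

section Polar

open Filter Topology

variable {X : Type*} [MeasurableSpace X]

lemma measure_closedBall_zero_of_le_rpow [PseudoMetricSpace X] {σ : Measure X} {x : X} {t : ℝ}
    {c : ℝ≥0∞} (ht : 0 < t) (hc : c ≠ ∞)
    (hball : ∀ r ∈ Ioc (0 : ℝ) 1, σ (closedBall x r) ≤ c * ENNReal.ofReal (r ^ t)) :
    σ (closedBall x 0) = 0 := by
  have hpow : Tendsto (fun r : ℝ ↦ ENNReal.ofReal (r ^ t)) (𝓝[>] 0) (𝓝 0) := by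
    have hcont : Continuous fun r : ℝ ↦ ENNReal.ofReal (r ^ t) :=
      ENNReal.continuous_ofReal.comp (Real.continuous_rpow_const ht.le)
    simpa [Real.zero_rpow ht.ne'] using (hcont.tendsto 0).mono_left nhdsWithin_le_nhds
  have hlim : Tendsto (fun r : ℝ ↦ c * ENNReal.ofReal (r ^ t)) (𝓝[>] 0) (𝓝 0) := by
    simpa using ENNReal.Tendsto.const_mul hpow (.inr hc)
  refine nonpos_iff_eq_zero.1 (ge_of_tendsto hlim ?_)
  filter_upwards [Ioc_mem_nhdsGT one_pos] with r hr
  exact (measure_mono (closedBall_subset_closedBall hr.1.le)).trans (hball r hr)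

lemma rieszPotential_ne_top_of_measure_closedBall_le [PseudoMetricSpace X]
    [OpensMeasurableSpace X] {σ : Measure X} [IsFiniteMeasure σ] {x : X} {t t' : ℝ} {c : ℝ≥0∞}
    (ht : 0 < t) (htt' : t < t') (hc : c ≠ ∞)
    (hball : ∀ r ∈ Ioc (0 : ℝ) 1, σ (closedBall x r) ≤ c * ENNReal.ofReal (r ^ t')) :
    rieszPotential t σ x ≠ ∞ := by
  have hlevel : ∀ τ > 0, σ {y | τ ≤ (dist x y)⁻¹} ≤ σ (closedBall x τ⁻¹) := fun τ hτ ↦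
    measure_mono fun y hy ↦ by
      have hdist : 0 < (dist x y)⁻¹ := hτ.trans_le hy
      rw [mem_closedBall']
      exact (le_inv_comm₀ hτ (inv_pos.1 hdist)).1 hy
  have hfin := lintegral_Ioi_rpow_mul_le ht htt' one_pos
    (g := fun τ ↦ σ {y | τ ≤ (dist x y)⁻¹}) (fun _ _ ↦ measure_mono (subset_univ _))
    (B := c) fun τ hτ ↦ by
      have hτ0 : 0 < τ := one_pos.trans hτ
      refine (hlevel τ hτ0).trans ?_
      rw [Real.rpow_neg hτ0.le, ← Real.inv_rpow hτ0.le]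
      exact hball _ ⟨inv_pos.2 hτ0, inv_le_one_of_one_le₀ (le_of_lt hτ)⟩
  have hlayer : rieszPotential t σ x = ENNReal.ofReal t *
      ∫⁻ τ in Ioi 0, ENNReal.ofReal (τ ^ (t - 1)) * σ {y | τ ≤ (dist x y)⁻¹} := by
    simp_rw [mul_comm (ENNReal.ofReal (_ ^ (t - 1)))]
    rw [← lintegral_rpow_eq_lintegral_meas_le_mul σ (.of_forall fun _ ↦ by positivity)
      (by fun_prop) ht]
    refine lintegral_congr_ae ?_
    filter_upwards [measure_eq_zero_iff_ae_notMem.1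
      (measure_closedBall_zero_of_le_rpow (ht.trans htt') hc hball)] with y hy
    rw [mem_closedBall', not_le] at hy
    rw [edist_dist, ENNReal.ofReal_rpow_of_pos hy, Real.rpow_neg hy.le, Real.inv_rpow hy.le]
  rw [hlayer]
  exact ENNReal.mul_ne_top ENNReal.ofReal_ne_top (ne_top_of_le_ne_top (by finiteness) hfin)

lemma exists_countable_cover_tsum_ediam_rpow_le [PseudoMetricSpace X] [SecondCountableTopology X]
    [OpensMeasurableSpace X] {σ : Measure X} {K : Set X} {t : ℝ} {c : ℝ≥0∞} (ht : 0 ≤ t)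
    (hc0 : c ≠ 0) (hc : c ≠ ∞)
    (hball : ∀ x ∈ K, ∃ r ∈ Ioc (0 : ℝ) 1, c * ENNReal.ofReal (r ^ t) ≤ σ (closedBall x r)) :
    ∃ u : Set X, ∃ ρ : X → ℝ, u.Countable ∧ K ⊆ ⋃ x : u, closedBall (x : X) (ρ x) ∧
      ∑' x : u, ediam (closedBall (x : X) (ρ x)) ^ t ≤ 10 ^ t * c⁻¹ * σ univ := by
  choose! r hr hσ using hball
  obtain ⟨u, huK, hdisj, hcover⟩ :=
    Vitali.exists_disjoint_subfamily_covering_enlargement_closedBall K id r 1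
      (fun x hx ↦ (hr x hx).2) 5 (by norm_num)
  have hu : u.Countable := hdisj.countable_of_nonempty_interior fun x hx ↦
    ⟨x, ball_subset_interior_closedBall (mem_ball_self (hr x (huK hx)).1)⟩
  have := hu.to_subtype
  refine ⟨u, fun x ↦ 5 * r x, hu, fun x hx ↦ ?_, ?_⟩
  · obtain ⟨b, hb, hxb⟩ := hcover x hx
    exact mem_iUnion.2 ⟨⟨b, hb⟩, hxb (mem_closedBall_self (hr x hx).1.le)⟩
  have hdiam : ∀ x : u, ediam (closedBall (x : X) (5 * r x)) ^ t ≤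
      10 ^ t * c⁻¹ * σ (closedBall (x : X) (r x)) := fun x ↦ by
    have hr0 := (hr x (huK x.2)).1
    calc ediam (closedBall (x : X) (5 * r x)) ^ t
        ≤ (10 * ENNReal.ofReal (r x)) ^ t := by
          gcongr
          rw [← closedEBall_ofReal (by positivity)]
          refine ediam_closedEBall_le.trans_eq ?_
          rw [ENNReal.ofReal_mul (by norm_num), ← mul_assoc]
          norm_num
      _ = 10 ^ t * ENNReal.ofReal (r x ^ t) := by
          rw [ENNReal.mul_rpow_of_nonneg _ _ ht, ENNReal.ofReal_rpow_of_pos hr0]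
      _ ≤ 10 ^ t * (c⁻¹ * σ (closedBall (x : X) (r x))) := by
          gcongr
          rw [← ENNReal.div_eq_inv_mul, ENNReal.le_div_iff_mul_le (.inl hc0) (.inl hc), mul_comm]
          exact hσ x (huK x.2)
      _ = 10 ^ t * c⁻¹ * σ (closedBall (x : X) (r x)) := (mul_assoc _ _ _).symm
  refine (ENNReal.tsum_le_tsum hdiam).trans ?_
  rw [ENNReal.tsum_mul_left]
  gcongr
  refine tsum_measure_le_measure_univ (fun x ↦ measurableSet_closedBall.nullMeasurableSet)
    fun x y hxy ↦ ?_
  exact (hdisj x.2 y.2 (by simpa [Subtype.ext_iff] using hxy)).aedisjoint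

lemma hausdorffMeasure_eq_zero_of_forall_cover [EMetricSpace X] [BorelSpace X] {K : Set X} {t : ℝ}
    (ht : 0 < t)
    (hcover : ∀ ε : ℝ≥0∞, ε ≠ 0 → ∃ (ι : Type*) (_ : Countable ι) (s : ι → Set X),
      K ⊆ ⋃ i, s i ∧ ∑' i, ediam (s i) ^ t ≤ ε) :
    Measure.hausdorffMeasure t K = 0 := by
  let ε : ℕ → ℝ≥0∞ := fun n ↦ (n : ℝ≥0∞)⁻¹
  have hε : Tendsto ε atTop (𝓝 0) := ENNReal.tendsto_inv_nat_nhds_zero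
  choose ι _ s hs hsum using fun n ↦ hcover (ε n) (ENNReal.inv_ne_zero.2 (by simp))
  have hdiam : Tendsto (fun n ↦ ε n ^ t⁻¹) atTop (𝓝 0) := by
    simpa [ht, Function.comp_def] using
      ((ENNReal.continuous_rpow_const (y := t⁻¹)).tendsto 0).comp hε
  refine nonpos_iff_eq_zero.1 ((Measure.hausdorffMeasure_le_liminf_tsum t K _ hdiam s
    (.of_forall fun n i ↦ ?_) (.of_forall hs)).trans ?_)
  · rw [ENNReal.le_rpow_inv_iff ht]
    exact (ENNReal.le_tsum i).trans (hsum n)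
  · rw [← hε.liminf_eq]
    exact liminf_le_liminf (.of_forall hsum)

lemma hausdorffMeasure_eq_zero_of_rieszPotential_eq_top [MetricSpace X] [SecondCountableTopology X]
    [BorelSpace X] {σ : Measure X} [IsFiniteMeasure σ] {K : Set X} {t t' : ℝ} (ht : 0 < t)
    (htt' : t < t') (hK : ∀ x ∈ K, rieszPotential t σ x = ∞) :
    Measure.hausdorffMeasure t' K = 0 := by
  have ht' : 0 < t' := ht.trans htt'
  refine hausdorffMeasure_eq_zero_of_forall_cover ht' fun ε hε ↦ ?_
  set c : ℝ≥0∞ := 10 ^ t' * σ univ / ε + 1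
  have hc : c ≠ ∞ := by finiteness
  have hc0 : c ≠ 0 := by simp [c]
  obtain ⟨u, ρ, hu, hcover, hsum⟩ := exists_countable_cover_tsum_ediam_rpow_le (σ := σ) (K := K)
    ht'.le hc0 hc fun x hx ↦ by
      by_contra! hsmall
      exact rieszPotential_ne_top_of_measure_closedBall_le ht htt' hc
        (fun r hr ↦ (hsmall r hr).le) (hK x hx)
  refine ⟨u, hu.to_subtype, _, hcover, hsum.trans ?_⟩
  rw [mul_right_comm, ← div_eq_mul_inv, ENNReal.div_le_iff_le_mul (.inl hc0) (.inl hc), mul_comm ε,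
    ← ENNReal.div_le_iff_le_mul (.inl hε) (.inr hc0)]
  exact le_self_add

lemma exists_le_measure_univ_of_hausdorffMeasure_ne_zero [MetricSpace X]
    [SecondCountableTopology X] [BorelSpace X] {K : Set X} {t t' : ℝ} (ht : 0 < t)
    (htt' : t < t') (hK : Measure.hausdorffMeasure t' K ≠ 0) :
    ∃ ε : ℝ≥0, 0 < ε ∧ ∀ σ : Measure X, (∀ x ∈ K, 1 ≤ rieszPotential t σ x) → ε ≤ σ univ := by
  obtain ⟨ε, hε0, hεsum⟩ := ENNReal.exists_pos_sum_of_countable one_ne_zero ℕ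
  by_contra! hcon
  -- A sum of measures with summable masses whose potentials all exceed `1` on `K` is a finite
  -- measure with infinite potential on `K`.
  choose σ hσK hσ using fun n ↦ hcon (ε n) (hε0 n)
  have : IsFiniteMeasure (Measure.sum σ) := ⟨by
    rw [Measure.sum_apply _ MeasurableSet.univ]
    exact (ENNReal.tsum_le_tsum fun n ↦ (hσ n).le).trans_lt (hεsum.trans ENNReal.one_lt_top)⟩
  refine hK (hausdorffMeasure_eq_zero_of_rieszPotential_eq_top (σ := Measure.sum σ) ht htt'
    fun x hx ↦ ?_)
  rw [rieszPotential, lintegral_sum_measure, eq_top_iff,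
    ← ENNReal.tsum_const_eq_top_of_ne_zero (α := ℕ) (one_ne_zero' ℝ≥0∞)]
  exact ENNReal.tsum_le_tsum fun n ↦ hσK n x hx

end Polar

section Sublinear

lemma exists_linearMap_le_sublinear {E : Type*} [AddCommGroup E] [Module ℝ E] {p : E → ℝ}
    (hsmul : ∀ c > (0 : ℝ), ∀ x, p (c • x) = c * p x) (hadd : ∀ x y, p (x + y) ≤ p x + p y)
    (x₀ : E) : ∃ L : E →ₗ[ℝ] ℝ, (∀ x, L x ≤ p x) ∧ L x₀ = p x₀ := by
  have hzero : p 0 = 0 := by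
    have := hsmul 2 two_pos 0
    rw [smul_zero] at this
    linarith
  have hwd : ∀ c : ℝ, c • x₀ = 0 → c • p x₀ = 0 := fun c hc ↦ by
    rcases smul_eq_zero.1 hc with rfl | rfl
    · exact zero_smul _ _
    · rw [hzero, smul_zero]
  have hray : ∀ c : ℝ, c * p x₀ ≤ p (c • x₀) := fun c ↦ by
    rcases lt_trichotomy c 0 with hc | rfl | hc
    · have := hadd (c • x₀) (-c • x₀)
      rw [← add_smul, add_neg_cancel, zero_smul, hzero, hsmul _ (neg_pos.2 hc)] at this
      linarith
    · rw [zero_smul, hzero, zero_mul]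
    · exact (hsmul c hc x₀).ge
  obtain ⟨L, hext, hL⟩ := exists_extension_of_le_sublinear
    (LinearPMap.mkSpanSingleton' x₀ (p x₀) hwd) p hsmul hadd <| by
      rintro ⟨x, hx⟩
      obtain ⟨c, rfl⟩ := Submodule.mem_span_singleton.1 hx
      exact (LinearPMap.mkSpanSingleton'_apply ..).trans_le (hray c)
  refine ⟨L, hL, (hext ⟨x₀, Submodule.mem_span_singleton_self x₀⟩).trans ?_⟩
  exact LinearPMap.mkSpanSingleton'_apply_self ..

lemma exists_measure_integral_le_sublinear {X : Type*} [TopologicalSpace X] [CompactSpace X]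
    [T2Space X] [MeasurableSpace X] [BorelSpace X] {p : C(X, ℝ) → ℝ}
    (hsmul : ∀ c > (0 : ℝ), ∀ f, p (c • f) = c * p f) (hadd : ∀ f g, p (f + g) ≤ p f + p g)
    (hnonpos : ∀ f ≤ 0, p f ≤ 0) (f₀ : C(X, ℝ)) :
    ∃ ν : Measure X, IsFiniteMeasure ν ∧ (∀ f : C(X, ℝ), ∫ x, f x ∂ν ≤ p f) ∧
      ∫ x, f₀ x ∂ν = p f₀ := by
  obtain ⟨L, hL, hL₀⟩ := exists_linearMap_le_sublinear hsmul hadd f₀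
  have hpos : ∀ f : C(X, ℝ), 0 ≤ f → 0 ≤ L f := fun f hf ↦ by
    have := (hL (-f)).trans (hnonpos (-f) (neg_nonpos.2 hf))
    rwa [map_neg, neg_nonpos] at this
  let Λ : CompactlySupportedContinuousMap X ℝ →ₚ[ℝ] ℝ := PositiveLinearMap.mk₀
    { toFun := fun f ↦ L (f : C(X, ℝ))
      map_add' := fun f g ↦ L.map_add (f : C(X, ℝ)) (g : C(X, ℝ))
      map_smul' := fun c f ↦ L.map_smul c (f : C(X, ℝ)) }
    fun f hf ↦ hpos _ hf
  have hrepr : ∀ f : C(X, ℝ), ∫ x, f x ∂(RealRMK.rieszMeasure Λ) = L f := fun f ↦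
    RealRMK.integral_rieszMeasure Λ (CompactlySupportedContinuousMap.continuousMapEquiv f)
  exact ⟨RealRMK.rieszMeasure Λ, inferInstance, fun f ↦ (hrepr f).trans_le (hL f),
    (hrepr f₀).trans hL₀⟩

end Sublinear

section DominatingMasses

variable {X Y : Type*} [MeasurableSpace Y]

/-- The total masses of the finite measures on `Y` whose `k`-potential dominates `f`. The infimum of
this set is a sublinear functional of `f`. -/
def dominatingMasses (k : X → Y → ℝ≥0∞) (f : X → ℝ) : Set ℝ :=
  {m | ∃ σ : Measure Y, IsFiniteMeasure σ ∧ σ.real univ = m ∧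
    ∀ x, ENNReal.ofReal (f x) ≤ ∫⁻ y, k x y ∂σ}

variable {k : X → Y → ℝ≥0∞} {f g : X → ℝ} {c m : ℝ}

lemma nonneg_of_mem_dominatingMasses (hm : m ∈ dominatingMasses k f) : 0 ≤ m := by
  obtain ⟨σ, _, rfl, _⟩ := hm
  exact measureReal_nonneg

lemma bddBelow_dominatingMasses : BddBelow (dominatingMasses k f) :=
  ⟨0, fun _ ↦ nonneg_of_mem_dominatingMasses⟩

lemma dominatingMasses_anti (hfg : f ≤ g) : dominatingMasses k g ⊆ dominatingMasses k f := by
  rintro _ ⟨σ, hσ, rfl, h⟩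
  exact ⟨σ, hσ, rfl, fun x ↦ (ENNReal.ofReal_le_ofReal (hfg x)).trans (h x)⟩

lemma smul_mem_dominatingMasses (hc : 0 ≤ c) (hm : m ∈ dominatingMasses k f) :
    c • m ∈ dominatingMasses k (c • f) := by
  obtain ⟨σ, hσ, rfl, h⟩ := hm
  refine ⟨ENNReal.ofReal c • σ, Measure.smul_finite _ ENNReal.ofReal_ne_top, ?_, fun x ↦ ?_⟩
  · rw [measureReal_ennreal_smul_apply, ENNReal.toReal_ofReal hc, smul_eq_mul]
  · rw [lintegral_smul_measure, smul_eq_mul, Pi.smul_apply, smul_eq_mul, ENNReal.ofReal_mul hc]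
    gcongr
    exact h x

lemma dominatingMasses_smul (hc : 0 < c) :
    dominatingMasses k (c • f) = c • dominatingMasses k f := by
  ext m
  rw [mem_smul_set_iff_inv_smul_mem₀ hc.ne']
  refine ⟨fun hm ↦ ?_, fun hm ↦ ?_⟩
  · simpa only [inv_smul_smul₀ hc.ne'] using smul_mem_dominatingMasses (inv_pos.2 hc).le hm
  · simpa only [smul_inv_smul₀ hc.ne'] using smul_mem_dominatingMasses hc.le hm

lemma dominatingMasses_add_subset :
    dominatingMasses k f + dominatingMasses k g ⊆ dominatingMasses k (f + g) := by
  rintro _ ⟨_, ⟨σ, hσ, rfl, hf⟩, _, ⟨τ, hτ, rfl, hg⟩, rfl⟩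
  refine ⟨σ + τ, inferInstance, measureReal_add_apply, fun x ↦ ?_⟩
  rw [lintegral_add_measure]
  exact ENNReal.ofReal_add_le.trans (add_le_add (hf x) (hg x))

lemma sInf_dominatingMasses_add_le (hf : (dominatingMasses k f).Nonempty)
    (hg : (dominatingMasses k g).Nonempty) :
    sInf (dominatingMasses k (f + g)) ≤
      sInf (dominatingMasses k f) + sInf (dominatingMasses k g) := by
  rw [← csInf_add hf bddBelow_dominatingMasses hg bddBelow_dominatingMasses]
  exact csInf_le_csInf bddBelow_dominatingMasses (hf.add hg) dominatingMasses_add_subset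

lemma zero_mem_dominatingMasses (hf : f ≤ 0) : (0 : ℝ) ∈ dominatingMasses k f :=
  ⟨0, inferInstance, by simp, fun x ↦ by simp [ENNReal.ofReal_of_nonpos (hf x)]⟩

lemma mem_dominatingMasses_of_le_mul [MeasurableSingletonClass Y] (y : Y) (hm : 0 ≤ m)
    (hf : ∀ x, ENNReal.ofReal (f x) ≤ ENNReal.ofReal m * k x y) : m ∈ dominatingMasses k f := by
  refine ⟨ENNReal.ofReal m • Measure.dirac y, Measure.smul_finite _ ENNReal.ofReal_ne_top, ?_,
    fun x ↦ ?_⟩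
  · simp [measureReal_ennreal_smul_apply, ENNReal.toReal_ofReal hm]
  · rw [lintegral_smul_measure, lintegral_dirac, smul_eq_mul]
    exact hf x

lemma exists_measure_integral_le_of_mem_dominatingMasses [TopologicalSpace X] [CompactSpace X]
    [T2Space X] [MeasurableSpace X] [BorelSpace X] (hk : (dominatingMasses k 1).Nonempty) :
    ∃ ν : Measure X, IsFiniteMeasure ν ∧ ν.real univ = sInf (dominatingMasses k 1) ∧
      ∀ f : C(X, ℝ), ∀ m ∈ dominatingMasses k f, ∫ x, f x ∂ν ≤ m := by
  have hne : ∀ f : C(X, ℝ), (dominatingMasses k f).Nonempty := fun f ↦ by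
    obtain ⟨m, hm⟩ := hk
    refine ⟨_, dominatingMasses_anti (fun x ↦ ?_)
      (smul_mem_dominatingMasses (norm_nonneg f) hm)⟩
    simpa using (le_abs_self _).trans (f.norm_coe_le_norm x)
  obtain ⟨ν, hν, hle, heq⟩ := exists_measure_integral_le_sublinear
    (p := fun f : C(X, ℝ) ↦ sInf (dominatingMasses k f))
    (fun c hc f ↦ by
      rw [ContinuousMap.coe_smul, dominatingMasses_smul hc, Real.sInf_smul_of_nonneg hc.le,
        smul_eq_mul])
    (fun f g ↦ sInf_dominatingMasses_add_le (hne f) (hne g))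
    (fun f hf ↦ csInf_le bddBelow_dominatingMasses (zero_mem_dominatingMasses hf)) 1
  refine ⟨ν, hν, ?_, fun f m hm ↦ (hle f).trans (csInf_le bddBelow_dominatingMasses hm)⟩
  simpa using heq

end DominatingMasses

section Frostman

variable {X : Type*}

lemma ofReal_exp_neg_mul_sq_dist_le [PseudoMetricSpace X] {t τ : ℝ} (ht : 0 < t) (hτ : 0 < τ)
    (x y : X) :
    ENNReal.ofReal (Real.exp (-(τ * dist x y ^ 2))) ≤
      ENNReal.ofReal ((t / 2) ^ (t / 2) * τ ^ (-(t / 2))) * edist x y ^ (-t) := by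
  have ht2 : 0 < t / 2 := half_pos ht
  rw [edist_dist, ← ofReal_sq_rpow_neg_half dist_nonneg]
  rcases (sq_nonneg (dist x y)).eq_or_lt with hq | hq
  · rw [← hq, ENNReal.ofReal_zero, ENNReal.zero_rpow_of_neg (neg_lt_zero.2 ht2), ENNReal.mul_top]
    · exact le_top
    · rw [Ne, ENNReal.ofReal_eq_zero, not_le]
      positivity
  · have hexp := rpow_mul_exp_neg_le ht2 (mul_pos hτ hq).le
    rw [ENNReal.ofReal_rpow_of_pos hq, ← ENNReal.ofReal_mul (by positivity), mul_assoc,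
      ← Real.mul_rpow hτ.le hq.le, Real.rpow_neg (by positivity)]
    refine ENNReal.ofReal_le_ofReal ?_
    rwa [← div_eq_mul_inv, le_div_iff₀' (by positivity)]

lemma nonempty_dominatingMasses_edist_rpow [PseudoMetricSpace X] [MeasurableSpace X]
    [MeasurableSingletonClass X] {t : ℝ} (ht : 0 ≤ t) {K : Set X} (hK : Bornology.IsBounded K) :
    (dominatingMasses (fun (x : K) (y : X) ↦ edist (x : X) y ^ (-t)) 1).Nonempty := by
  rcases K.eq_empty_or_nonempty with rfl | ⟨y, hy⟩
  · exact ⟨0, 0, inferInstance, by simp, fun x ↦ x.2.elim⟩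
  · have hD : 0 < diam K + 1 := by positivity
    refine ⟨(diam K + 1) ^ t, mem_dominatingMasses_of_le_mul y (by positivity) fun x ↦ ?_⟩
    have hdist : edist (x : X) y ≤ ENNReal.ofReal (diam K + 1) := by
      rw [edist_dist]
      exact ENNReal.ofReal_le_ofReal
        ((dist_le_diam_of_mem hK x.2 hy).trans (le_add_of_nonneg_right zero_le_one))
    calc ENNReal.ofReal ((1 : K → ℝ) x)
        = ENNReal.ofReal ((diam K + 1) ^ t) * ENNReal.ofReal (diam K + 1) ^ (-t) := by
          rw [ENNReal.ofReal_rpow_of_pos hD, ← ENNReal.ofReal_mul (by positivity),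
            ← Real.rpow_add hD, add_neg_cancel, Real.rpow_zero, Pi.one_apply]
      _ ≤ ENNReal.ofReal ((diam K + 1) ^ t) * edist (x : X) y ^ (-t) := by
          rw [ENNReal.rpow_neg, ENNReal.rpow_neg]
          gcongr

lemma exists_measure_integral_le_of_hausdorffMeasure_ne_zero [MetricSpace X]
    [SecondCountableTopology X] [MeasurableSpace X] [BorelSpace X] {t t' : ℝ} (ht : 0 < t)
    (htt' : t < t') {K : Set X} (hK : IsCompact K) (hKt' : Measure.hausdorffMeasure t' K ≠ 0) :
    ∃ ν : Measure K, IsFiniteMeasure ν ∧ ν ≠ 0 ∧ ∀ f : C(K, ℝ),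
      ∀ m ∈ dominatingMasses (fun (x : K) (y : X) ↦ edist (x : X) y ^ (-t)) f,
        ∫ x, f x ∂ν ≤ m := by
  have := isCompact_iff_compactSpace.1 hK
  have hne := nonempty_dominatingMasses_edist_rpow ht.le hK.isBounded
  obtain ⟨ν, hν, hmass, hle⟩ := exists_measure_integral_le_of_mem_dominatingMasses hne
  obtain ⟨ε, hε, hlow⟩ := exists_le_measure_univ_of_hausdorffMeasure_ne_zero ht htt' hKt'
  have hεmass : (ε : ℝ) ≤ ν.real univ := by
    rw [hmass]
    refine le_csInf hne ?_
    rintro _ ⟨σ, _, rfl, hσ⟩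
    exact ENNReal.toReal_mono (measure_ne_top _ _)
      (hlow σ fun x hx ↦ ENNReal.ofReal_one.symm.trans_le (hσ ⟨x, hx⟩))
  refine ⟨ν, hν, ?_, hle⟩
  rintro rfl
  rw [measureReal_zero_apply] at hεmass
  exact hεmass.not_gt hε

theorem exists_measure_hasGaussDecay_of_hausdorffMeasure_ne_zero [MetricSpace X]
    [SecondCountableTopology X] [MeasurableSpace X] [BorelSpace X] {t t' : ℝ} (ht : 0 < t)
    (htt' : t < t') {K : Set X} (hK : IsCompact K) (hKt' : Measure.hausdorffMeasure t' K ≠ 0) :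
    ∃ ν : Measure X, IsFiniteMeasure ν ∧ ν ≠ 0 ∧ ν Kᶜ = 0 ∧ HasGaussDecay ν t := by
  have := isCompact_iff_compactSpace.1 hK
  obtain ⟨ν, hν, hν0, hle⟩ := exists_measure_integral_le_of_hausdorffMeasure_ne_zero ht htt' hK hKt'
  have hval : Measurable (Subtype.val : K → X) := measurable_subtype_coe
  set B : ℝ := (t / 2) ^ (t / 2)
  have hB : 0 < B := by positivity
  have hpotential : ∀ τ > 0, ∀ x : X,
      ∫⁻ y, ENNReal.ofReal (Real.exp (-(τ * dist x y ^ 2))) ∂(ν.map Subtype.val) ≤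
        ENNReal.ofReal (B * τ ^ (-(t / 2))) := fun τ hτ x ↦ by
    let f : C(K, ℝ) := ⟨fun y ↦ Real.exp (-(τ * dist x y ^ 2)), by fun_prop⟩
    rw [lintegral_map (by fun_prop) hval,
      ← ofReal_integral_eq_lintegral_ofReal (f := fun y : K ↦ Real.exp (-(τ * dist x y ^ 2)))
        (f.continuous.integrable_of_hasCompactSupport (.of_compactSpace f))
        (.of_forall fun _ ↦ Real.exp_nonneg _)]
    refine ENNReal.ofReal_le_ofReal (hle f _ (mem_dominatingMasses_of_le_mul x (by positivity)
      fun y ↦ ?_))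
    rw [edist_comm]
    exact ofReal_exp_neg_mul_sq_dist_le ht hτ x y
  refine ⟨ν.map Subtype.val, inferInstance, ?_, ?_, ENNReal.ofReal B * ν univ,
    by finiteness, fun τ hτ ↦ ?_⟩
  · rwa [Ne, Measure.map_eq_zero_iff hval.aemeasurable]
  · rw [Measure.map_apply hval hK.measurableSet.compl]
    simp
  · rw [gaussEnergy, lintegral_prod _ (by fun_prop)]
    refine (lintegral_mono (hpotential τ hτ)).trans_eq ?_
    rw [lintegral_const, Measure.map_apply hval .univ, preimage_univ, ENNReal.ofReal_mul hB.le]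
    ring

lemma exists_measure_hasGaussDecay_of_lt_dimH [MetricSpace X]
    [SecondCountableTopology X] [MeasurableSpace X] [BorelSpace X] {Z : Set X} (hZ : IsCompact Z)
    (hZne : Z.Nonempty) {t : ℝ≥0} (ht : t = 0 ∨ (t : ℝ≥0∞) < dimH Z) :
    ∃ ν : Measure X, IsFiniteMeasure ν ∧ ν ≠ 0 ∧ ν Zᶜ = 0 ∧ HasGaussDecay ν t := by
  rcases eq_or_ne t 0 with rfl | ht0
  · obtain ⟨z, hz⟩ := hZne
    refine ⟨Measure.dirac z, inferInstance, Measure.dirac_ne_zero, by simp [hz], 1,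
      ENNReal.one_ne_top, fun τ hτ ↦ ?_⟩
    simpa using gaussEnergy_le_measure_univ_sq hτ.le (Measure.dirac z)
  · obtain ⟨t', htt', ht'⟩ := ENNReal.lt_iff_exists_nnreal_btwn.1 (ht.resolve_left ht0)
    refine exists_measure_hasGaussDecay_of_hausdorffMeasure_ne_zero (t' := t') (by positivity)
      (by exact_mod_cast htt') hZ ?_
    rw [hausdorffMeasure_of_lt_dimH ht']
    exact ENNReal.top_ne_zero

end Frostman

section Convolution

variable {G : Type*} [AddMonoid G] [MeasurableSpace G] [MeasurableAdd₂ G] {μ ν : Measure G}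
  [SFinite ν]

lemma conv_ne_zero (hμ : μ ≠ 0) (hν : ν ≠ 0) : μ ∗ ν ≠ 0 := by
  rw [← Measure.measure_univ_ne_zero] at hμ hν ⊢
  rw [Measure.conv, Measure.map_apply measurable_add .univ, preimage_univ, ← univ_prod_univ,
    Measure.prod_prod]
  exact mul_ne_zero hμ hν

lemma conv_compl_add_eq_zero {A B : Set G} (hAB : MeasurableSet (A + B)) (hμ : μ Aᶜ = 0)
    (hν : ν Bᶜ = 0) : (μ ∗ ν) (A + B)ᶜ = 0 := by
  rw [Measure.conv, Measure.map_apply measurable_add hAB.compl]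
  have hcover : (fun p : G × G ↦ p.1 + p.2) ⁻¹' (A + B)ᶜ ⊆ Aᶜ ×ˢ univ ∪ univ ×ˢ Bᶜ := fun p hp ↦ by
    by_contra hcon
    simp only [mem_union, mem_prod, mem_compl_iff, mem_univ, and_true, true_and, not_or,
      not_not] at hcon
    exact hp (add_mem_add hcon.1 hcon.2)
  refine measure_mono_null hcover (measure_union_null ?_ ?_)
  · rw [Measure.prod_prod, hμ, zero_mul]
  · rw [Measure.prod_prod, hν, mul_zero]

end Convolution

section Sumset

lemma dimH_le_dimH_add {G : Type*} [AddGroup G] [EMetricSpace G] [IsIsometricVAdd G G]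
    {A B : Set G} (hA : A.Nonempty) : dimH B ≤ dimH (A + B) := by
  obtain ⟨a, ha⟩ := hA
  rw [← (isometry_vadd G a).dimH_image B]
  exact dimH_mono (image_subset_iff.2 fun b hb ↦ add_mem_add ha hb)

lemma exists_add_eq_of_lt_add {F H : ℝ≥0∞} {w : ℝ≥0} (hF : 0 < F) (hw : 0 < w)
    (hwFH : w < F + H) :
    ∃ s t : ℝ≥0, 0 < s ∧ s < F ∧ (t = 0 ∨ t < H) ∧ s + t = w := by
  rcases lt_or_ge (w : ℝ≥0∞) F with hwF | hFw
  · exact ⟨w, 0, hw, hwF, .inl rfl, add_zero w⟩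
  · have hsub : w - F < min H w := lt_min (ENNReal.sub_lt_of_lt_add hFw (by rwa [add_comm]))
      (ENNReal.sub_lt_self ENNReal.coe_ne_top (by simpa using hw.ne') hF.ne')
    obtain ⟨t, hwt, ht⟩ := ENNReal.lt_iff_exists_nnreal_btwn.1 hsub
    obtain ⟨htH, htw⟩ := lt_min_iff.1 ht
    have htw : t < w := by exact_mod_cast htw
    refine ⟨w - t, t, tsub_pos_of_lt htw, ?_, .inr htH, tsub_add_cancel_of_le htw.le⟩
    rw [ENNReal.coe_sub]
    exact ENNReal.sub_lt_of_sub_lt (by exact_mod_cast htw.le) (.inl ENNReal.coe_ne_top) hwt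

variable {d : ℕ} {A Z : Set (EuclideanSpace ℝ (Fin d))}

lemma exists_hasFourierDecay_of_lt_dimF {s : ℝ≥0} (hs : (s : ℝ≥0∞) < dimF A) :
    ∃ μ ∈ compactlySupportedMeasures A, HasFourierDecay μ s := by
  obtain ⟨_, ⟨s', rfl, -, μ, hμ, C, hC⟩, hss'⟩ := lt_sSup_iff.1 hs
  have hss' : s < s' := by exact_mod_cast hss'
  have := hμ.2.1
  exact ⟨μ, hμ, (hasFourierDecay_of_measureFourier_le
    (NNReal.coe_pos.2 (pos_of_gt hss')) hC).mono s.coe_nonneg (by exact_mod_cast hss'.le)⟩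

theorem min_dimF_add_dimH_le_dimH_add (hA : A.Nonempty) (hZ : IsCompact Z) (hZne : Z.Nonempty) :
    min (dimF A + dimH Z) d ≤ dimH (A + Z) := by
  rcases eq_or_ne (dimF A) 0 with hF | hF
  · rw [hF, zero_add]
    exact (min_le_left _ _).trans (dimH_le_dimH_add hA)
  refine ENNReal.le_of_forall_nnreal_lt fun v hv ↦ ?_
  obtain ⟨w, hvw, hw⟩ := ENNReal.lt_iff_exists_nnreal_btwn.1 hv
  obtain ⟨hwFH, hwd⟩ := lt_min_iff.1 hw
  have hvw : v < w := by exact_mod_cast hvw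
  obtain ⟨s, t, hs, hsF, htH, rfl⟩ :=
    exists_add_eq_of_lt_add (pos_iff_ne_zero.2 hF) (pos_of_gt hvw) hwFH
  obtain ⟨μ, ⟨hμ, _, hμcompact, hμA⟩, hfourier⟩ := exists_hasFourierDecay_of_lt_dimF hsF
  obtain ⟨ν, _, hν, hνZ, hgauss⟩ := exists_measure_hasGaussDecay_of_lt_dimH hZ hZne htH
  have hdecay : HasGaussDecay (μ ∗ ν) (s + t : ℝ≥0) :=
    hfourier.hasGaussDecay_conv hgauss (by exact_mod_cast hs)
      (by rw [finrank_euclideanSpace_fin]; exact_mod_cast hwd)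
  calc (v : ℝ≥0∞) ≤ dimH (μ.support + Z) :=
        hdecay.le_dimH hvw (conv_ne_zero hμ hν) (conv_compl_add_eq_zero
          (hμcompact.add hZ).measurableSet Measure.measure_compl_support hνZ)
    _ ≤ dimH (A + Z) := dimH_mono (add_subset_add_right hμA)

theorem mainTheorem3_general (hA : IsCompact A) (hZ : IsCompact Z) (hAne : A.Nonempty)
    (hZne : Z.Nonempty) :
    min (max (dimF A + dimH Z) (dimH A + dimF Z)) d ≤ dimH (A + Z) := by
  rw [min_max_distrib_right]
  refine max_le (min_dimF_add_dimH_le_dimH_add hAne hZ hZne) ?_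
  rw [add_comm (dimH A), add_comm A]
  exact min_dimF_add_dimH_le_dimH_add hZne hA hAne

end Sumset

theorem mainTheorem3 (d : ℕ) (R : Set ℝ) (Y Z : Set (EuclideanSpace ℝ (Fin d)))
    (hR : R ⊆ Set.Ioi 0) (hRc : IsCompact R) (hYc : IsCompact Y) (hZc : IsCompact Z)
    (hRne : R.Nonempty) (hYne : Y.Nonempty) (hZne : Z.Nonempty)
    (hM : max (dimF (R • Y) + dimH Z) (dimH (R • Y) + dimF Z) ≤ (d : ℝ≥0∞)) :
    max (dimF (R • Y) + dimH Z) (dimH (R • Y) + dimF Z) ≤ dimH (R • Y + Z) :=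
  (min_eq_left hM).symm.trans_le
    (mainTheorem3_general (hRc.smul_set hYc) hZc (hRne.smul hYne) hZne)
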